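/- **Conventions.** A *normal o-graph* is an oriented virtual link diagram, considered up to planar isotopy and the virtual Reidemeister-type moves, so that only the signed real crossings and the way they are connected along the strands matter (every component has a real crossing); *open* normal o-graphs (tangle diagrams) may also have open ends at which strands enter or leave. A *local move* replaces a given open normal o-graph $L$ inside a larger diagram by another one $R$ with the same ends. A crossing represents a branched tetrahedron with vertices $0<1<2<3$: the four edges at the crossing are dual to its faces (face $f$ is opposite to the vertex $f$), the over strand joins the faces $0,1$, the under strand joins the faces $2,3$; at a positive crossing the strands come in through the faces $0,2$ and go out through the faces $1,3$, at a negative crossing conversely. *MP moves.* The 16 (Matveev--Piergallini) MP moves are the local moves dual to those branched Pachner $2$-$3$ moves that preserve the associated vector field: for $i<j$ in $\{0,\dots,4\}$ with $\{i,j\}\ne\{0,1\},\{3,4\}$ and for each of the two orientations, the two tetrahedra opposite to the vertices $i,j$ in the boundary of the ordered $4$-simplex $0<1<2<3<4$ are replaced by the three other tetrahedra. The *primary MP move* is the move on three parallel strands $1,2,3$ with only positive crossings, in which the strand with the smaller number is always the over strand: the diagram with a crossing of the strands $2,3$ followed by a crossing of $1,2$ is replaced by the diagram with crossings of $1,2$,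 then $1,3$, then $2,3$. *Pure sliding moves.* In the circuit diagram of a normal o-graph each edge carries three lines, numbered from left to right; for the edge dual to a triangle $a<b<c$ they correspond to $ab$, $bc$, $ac$ in this order, and two lines are joined at a crossing if they correspond to the same edge of the dual tetrahedron there. A pure sliding move lets one of two distinct edges (left, right) run over the other one in two new crossings of opposite signs. There are four types, each of which may be performed only if two lines lie on the same circuit: * ps-I: third line on the left and second line on the right; parallel edges, left edge over, first crossing positive; * ps-II: third line on the left and first line on the right; parallel edges, right edge over, first crossing negative; * ps-III: first line on the left and second line on the right; antiparallel edges, left edge over, the over strand meets the positive crossing first; * ps-IV: third line on the left and third line on the right; antiparallel edges, the over strand meets the negative crossing first. A *local pure sliding move* is a pure sliding move performed on the two-crossing side $L$ of an MP move $M$, as a local move, such that its condition already holds in the circuit diagram of the open diagram $L$, and such that $M=N^{-1}\circ(\text{this pure sliding move})$ for some MP move $N$. **Proposition.** There is a set $S$ of exactly 18 local pure sliding moves with the following property. For every MP move $M$ there is a subset $A\subseteq S$ of 15 moves such that every MP move is a sequence of moves each of which is $M$, a move from $A$, or the inverse of one of these: whenever a normal o-graph $\Gamma'$ (possibly with open ends)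 is obtained from $\Gamma$ by an MP move, $\Gamma$ and $\Gamma'$ are related by such a sequence. Moreover, there is also a subset $A\subseteq S$ of 15 moves such that every MP move is a sequence of moves each of which is the primary MP move, a move from $A$, or the inverse of one of these. -/

import Mathlib

/-- The two strands that meet at a real crossing. -/
inductive Strand
  | over
  | under
  deriving DecidableEq

instance : Fintype Strand :=
  ⟨{Strand.over, Strand.under}, fun s => by cases s <;> decide⟩

/-- A normal o-graph with open ends: an oriented virtual link (tangle) diagram up to planar isotopy
and the Reidemeister type moves, which forget everything but the signed real crossings and the way
they are joined.
`I` is the set of open ends at which the diagram is entered, `O` the set of open ends at which it is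
left; a (closed) normal o-graph is the case `I = O = ∅`.
Every crossing has one outgoing and one incoming half-edge on each of its two strands. An edge
leaves a crossing along a strand, or starts at an end in `I`; `next` says where it arrives: at a
crossing along a strand, or at an end in `O`. There are no components without crossings, since the
singular set of a standard polyhedron has none. -/
structure OGraph (I O : Type) where
  /-- the real crossings (true vertices) -/
  V : Type
  fin : Finite V
  /-- `true` for a positive crossing, `false` for a negative one -/
  pos : V → Bool
  /-- the edges, from their start to their end -/
  next : (V × Strand) ⊕ I ≃ (V × Strand) ⊕ O

namespace OGraph

variable {I O : Type}

/-- The edges of a normal o-graph, named by their starts. -/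
abbrev Edge (Γ : OGraph I O) : Type := (Γ.V × Strand) ⊕ I

/-! ### The circuit diagram (Method B)

A crossing is dual to a branched tetrahedron with vertices `0 < 1 < 2 < 3`, and the four edges at it
are dual to the faces of the tetrahedron; face `f` is the one opposite to the vertex `f`. The over
strand joins the faces `0` and `1`, the under strand joins the faces `2` and `3`. At a positive
crossing the strands come in through the faces `0`, `2` and go out through the faces `1`, `3`; at a
negative crossing it is the other way round.

An edge of the o-graph, dual to a triangle `a < b < c`, carries three lines, counted from left to
right: the first one is dual to `ab`, the second one to `bc`, and the third one (the local `2`-cell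
that starts the branching) to `ac`. -/

/-- The strand of a crossing that passes through the face `f` of the dual tetrahedron. -/
def faceStrand (f : Fin 4) : Strand := if f.val < 2 then Strand.over else Strand.under

/-- The edge of `Γ` that is dual to the face `f` of the tetrahedron dual to the crossing `v`. -/
def faceEdge (Γ : OGraph I O) (v : Γ.V) (f : Fin 4) : Γ.Edge :=
  if (f.val % 2 == 0) = Γ.pos v then Γ.next.symm (Sum.inl (v, faceStrand f))
  else Sum.inl (v, faceStrand f)

/-- The edge of the tetrahedron that is dual to line number `k` (counted from `0`) on the edge of the
o-graph that is dual to the face `f`. -/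
def lineDual (f : Fin 4) (k : Fin 3) : Fin 4 × Fin 4 :=
  match k with
  | 0 => (f.succAbove 0, f.succAbove 1)
  | 1 => (f.succAbove 1, f.succAbove 2)
  | 2 => (f.succAbove 0, f.succAbove 2)

/-- The circuit diagram joins two lines at a crossing when they bound the same local `2`-cell there,
that is, when they are dual to the same edge of the dual tetrahedron. -/
def LineJoined (Γ : OGraph I O) (x y : Γ.Edge × Fin 3) : Prop :=
  ∃ (v : Γ.V) (f g : Fin 4), Γ.faceEdge v f = x.1 ∧ Γ.faceEdge v g = y.1 ∧
    lineDual f x.2 = lineDual g y.2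

/-- Two lines lie on the same circuit of the circuit diagram. -/
def LineConnected (Γ : OGraph I O) : Γ.Edge × Fin 3 → Γ.Edge × Fin 3 → Prop :=
  Relation.EqvGen Γ.LineJoined

/-! ### Inserting a local move into a context -/

/-- `Γ` is the result of putting the diagram `T` into the hole of the context `C`.
The context has, besides the ends `I`, `O` of `Γ`, the ends `Q` at which `T` is left (and `C` is
entered) and the ends `J` at which `T` is entered (and `C` is left). The crossings of `Γ` are those
of `C` and of `T`, with their signs; the edges of `T` between crossings are edges of `Γ`; and every
edge `a → b` of `C` becomes an edge of `Γ`, prolonged at its start by the edge of `T` that ends at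
`a` if `a` is in `Q`, and at its end by the edge of `T` that starts at `b` if `b` is in `J`.
This is used only for `T` in which each edge has a crossing at one of its ends at least. -/
def IsGlued {J Q : Type} (C : OGraph (Q ⊕ I) (J ⊕ O)) (T : OGraph J Q) (Γ : OGraph I O) : Prop :=
  ∃ ι : C.V ⊕ T.V ≃ Γ.V,
    (∀ v, Γ.pos (ι (Sum.inl v)) = C.pos v) ∧
    (∀ v, Γ.pos (ι (Sum.inr v)) = T.pos v) ∧
    (∀ v s w t, T.next (Sum.inl (v, s)) = Sum.inl (w, t) →
      Γ.next (Sum.inl (ι (Sum.inr v), s)) = Sum.inl (ι (Sum.inr w), t)) ∧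
    (∀ (a : (C.V × Strand) ⊕ (Q ⊕ I)) (x : (Γ.V × Strand) ⊕ I) (y : (Γ.V × Strand) ⊕ O),
      (match a with
        | Sum.inl (v, s) => x = Sum.inl (ι (Sum.inl v), s)
        | Sum.inr (Sum.inl q) =>
            ∃ v s, T.next (Sum.inl (v, s)) = Sum.inr q ∧ x = Sum.inl (ι (Sum.inr v), s)
        | Sum.inr (Sum.inr i) => x = Sum.inr i) →
      (match C.next a with
        | Sum.inl (v, s) => y = Sum.inl (ι (Sum.inl v), s)
        | Sum.inr (Sum.inl j) =>
            ∃ v s, T.next (Sum.inr j) = Sum.inl (v, s) ∧ y = Sum.inl (ι (Sum.inr v), s)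
        | Sum.inr (Sum.inr o) => y = Sum.inr o) →
      Γ.next x = y)

/-- The local move that replaces `L` by `R`, performed somewhere in `Γ`, gives `Γ'`. -/
def LocalMove {J Q : Type} (L R : OGraph J Q) (Γ Γ' : OGraph I O) : Prop :=
  ∃ C : OGraph (Q ⊕ I) (J ⊕ O), IsGlued C L Γ ∧ IsGlued C R Γ'

end OGraph

/-! ### Pure sliding moves -/

/-- The four types ps-I, ps-II, ps-III, ps-IV of pure sliding moves. -/
inductive PSKind
  | I
  | II
  | III
  | IV
  deriving DecidableEq

namespace PSKind

/-- The line on the left edge in the conditions (PS-I) -- (PS-IV), counted from `0`. -/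
def leftLine : PSKind → Fin 3
  | I => 2
  | II => 2
  | III => 0
  | IV => 2

/-- The line on the right edge in the conditions (PS-I) -- (PS-IV), counted from `0`. -/
def rightLine : PSKind → Fin 3
  | I => 1
  | II => 0
  | III => 1
  | IV => 2

/-- Whether the left edge is the over strand of the two new crossings. (In type IV the picture with
the right edge over is the same one, turned by `π`.) -/
def leftOver : PSKind → Bool
  | I => true
  | II => false
  | III => true
  | IV => true

/-- The sign of the new crossing that the over strand meets first. -/
def overFirst : PSKind → Bool
  | I => true
  | II => false
  | III => true
  | IV => false

/-- The sign of the new crossing that the under strand meets first. It is the same crossing when the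
two edges are parallel (I, II), and the other one when they are antiparallel (III, IV). -/
def underFirst : PSKind → Bool
  | I => true
  | II => false
  | III => false
  | IV => true

end PSKind

namespace OGraph

variable {I O : Type}

/-- The disjoint union of `Γ` and two crossings, `true` (positive) and `false` (negative), whose over
strands form a circle, and whose under strands form a circle. -/
def addPair (Γ : OGraph I O) :
    ((Γ.V ⊕ Bool) × Strand) ⊕ I ≃ ((Γ.V ⊕ Bool) × Strand) ⊕ O where
  toFun
    | Sum.inl (Sum.inl v, s) => (Γ.next (Sum.inl (v, s))).map (Prod.map Sum.inl id) id
    | Sum.inl (Sum.inr c, s) => Sum.inl (Sum.inr (!c), s)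
    | Sum.inr i => (Γ.next (Sum.inr i)).map (Prod.map Sum.inl id) id
  invFun
    | Sum.inl (Sum.inl v, s) => (Γ.next.symm (Sum.inl (v, s))).map (Prod.map Sum.inl id) id
    | Sum.inl (Sum.inr c, s) => Sum.inl (Sum.inr (!c), s)
    | Sum.inr o => (Γ.next.symm (Sum.inr o)).map (Prod.map Sum.inl id) id
  left_inv := by
    rintro (⟨v | c, s⟩ | i)
    · rcases h : Γ.next (Sum.inl (v, s)) with ⟨w, t⟩ | o <;>
        simp [h, (Equiv.symm_apply_eq _).2 h.symm]
    · simp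
    · rcases h : Γ.next (Sum.inr i) with ⟨w, t⟩ | o <;>
        simp [h, (Equiv.symm_apply_eq _).2 h.symm]
  right_inv := by
    rintro (⟨v | c, s⟩ | o)
    · rcases h : Γ.next.symm (Sum.inl (v, s)) with ⟨w, t⟩ | i <;>
        simp [h, ← (Equiv.symm_apply_eq _).1 h]
    · simp
    · rcases h : Γ.next.symm (Sum.inr o) with ⟨w, t⟩ | i <;>
        simp [h, ← (Equiv.symm_apply_eq _).1 h]

/-- An edge of `Γ`, as an edge (start) in a diagram with two more crossings. -/
def oldEdge (Γ : OGraph I O) : Γ.Edge → ((Γ.V ⊕ Bool) × Strand) ⊕ I :=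
  Sum.map (Prod.map Sum.inl id) id

open Classical in
/-- Let the edge `a` of `Γ` run over the edge `b` twice, in two new crossings of opposite signs: `a`
is cut and runs first through the crossing `c`, then through `!c`, as the over strand, and `b` is cut
and runs first through the crossing `d`, then through `!d`, as the under strand. (Exchanging the
successors of two edges merges a circle into an edge.) -/
noncomputable def insertPair (Γ : OGraph I O) (a b : Γ.Edge) (c d : Bool) : OGraph I O where
  V := Γ.V ⊕ Bool
  fin := by
    have := Γ.fin
    infer_instance
  pos := Sum.elim Γ.pos id
  next := ((Equiv.swap (Γ.oldEdge a) (Sum.inl (Sum.inr (!c), Strand.over))).trans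
    (Equiv.swap (Γ.oldEdge b) (Sum.inl (Sum.inr (!d), Strand.under)))).trans Γ.addPair

/-- The diagram after a pure sliding move of type `k` on the left edge `l` and the right edge `r`. -/
noncomputable def slide (Γ : OGraph I O) (k : PSKind) (l r : Γ.Edge) : OGraph I O :=
  if k.leftOver then Γ.insertPair l r k.overFirst k.underFirst
  else Γ.insertPair r l k.overFirst k.underFirst

/-- The pure sliding move of type `k` may be performed on the two edges `l` (left) and `r` (right):
the respective condition (PS-I) -- (PS-IV) holds in the circuit diagram of `Γ`. -/
def CanSlide (Γ : OGraph I O) (k : PSKind) (l r : Γ.Edge) : Prop :=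
  l ≠ r ∧ Γ.LineConnected (l, k.leftLine) (r, k.rightLine)

end OGraph

/-! ### The 16 MP moves

An MP move is dual to a branched Pachner `2`-`3` move, which exchanges two complementary parts of the
boundary of a `4`-simplex with totally ordered vertices `0 < 1 < 2 < 3 < 4`: the two tetrahedra
opposite to the vertices `i < j`, which share a triangle, and the three tetrahedra around the edge
`ij`. There are two orientations. If `{i, j}` is `{0, 1}` or `{3, 4}`, the move changes the vector
field ("bumping" moves); the other `8 · 2 = 16` moves are the MP moves. -/

namespace Simplex

/-- Whether the tetrahedron opposite to `k` is a positive crossing in the boundary of the ordered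
`4`-simplex with orientation `ε`. -/
def sgn (ε : Bool) (k : Fin 5) : Bool := (k.val % 2 == 0) == ε

/-- The face of the dual tetrahedron through which a strand leaves a crossing. -/
def outFace (positive : Bool) (s : Strand) : Fin 4 :=
  match positive, s with
  | true, Strand.over => 1
  | true, Strand.under => 3
  | false, Strand.over => 0
  | false, Strand.under => 2

/-- Where the edge arrives that leaves along a strand of the crossing opposite to the vertex `k`:
when it leaves through the face opposite to `l`, it arrives at the crossing opposite to `l`, through
the face opposite to `k`. -/
def step (ε : Bool) (h : Fin 5 × Strand) : Fin 5 × Strand :=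
  let l := h.1.succAbove (outFace (sgn ε h.1) h.2)
  (l, if h.1 < l then OGraph.faceStrand ⟨h.1.val % 4, Nat.mod_lt _ (by norm_num)⟩
      else OGraph.faceStrand ⟨(h.1.val - 1) % 4, Nat.mod_lt _ (by norm_num)⟩)

/-- The edges of the normal o-graph with five crossings that is dual to the boundary of the ordered
`4`-simplex. Changing the orientation reverses all of them. -/
def next (ε : Bool) : Equiv.Perm (Fin 5 × Strand) where
  toFun := step ε
  invFun := step (!ε)
  left_inv := by
    revert ε
    unfold Function.LeftInverse
    decide
  right_inv := by
    revert ε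
    unfold Function.RightInverse Function.LeftInverse
    decide

/-- The edges of a closed diagram that touch the set of crossings of colour `b`, from starts to ends.
An edge that arrives from the other colour starts at an open end, one that leaves for the other
colour ends at an open end; both are named by their start. -/
def cut {V : Type} (P : Equiv.Perm (V × Strand)) (K : V → Bool) (b : Bool) :
    ({v // K v = b} × Strand) ⊕ {h : V × Strand // K h.1 = (!b) ∧ K (P h).1 = b} ≃
    ({v // K v = b} × Strand) ⊕ {h : V × Strand // K h.1 = b ∧ K (P h).1 = (!b)} where
  toFun
    | Sum.inl (v, s) =>
        if hk : K (P (v.1, s)).1 = b then Sum.inl (⟨_, hk⟩, (P (v.1, s)).2)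
        else Sum.inr ⟨(v.1, s), v.2, Bool.eq_not.2 hk⟩
    | Sum.inr h => Sum.inl (⟨_, h.2.2⟩, (P h.1).2)
  invFun
    | Sum.inl (v, s) =>
        if hk : K (P.symm (v.1, s)).1 = b then Sum.inl (⟨_, hk⟩, (P.symm (v.1, s)).2)
        else Sum.inr ⟨P.symm (v.1, s), Bool.eq_not.2 hk, by simpa using v.2⟩
    | Sum.inr h => Sum.inl (⟨h.1.1, h.2.1⟩, h.1.2)
  left_inv := by
    rintro (⟨⟨v, hv⟩, s⟩ | ⟨⟨v, s⟩, h1, h2⟩)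
    · by_cases hk : K (P (v, s)).1 = b
      · simp [hk, hv]
      · simp [hk]
    · have hn : ¬ K v = b := Bool.eq_not.1 h1
      simp [hn]
  right_inv := by
    rintro (⟨⟨v, hv⟩, s⟩ | ⟨⟨v, s⟩, h1, h2⟩)
    · by_cases hk : K (P.symm (v, s)).1 = b
      · simp [hk, hv]
      · simp [hk]
    · have hn : ¬ K (P (v, s)).1 = b := Bool.eq_not.1 h2
      simp [hn]

end Simplex

/-- The 16 MP moves. -/
structure MPMove where
  /-- the smaller of the two vertices that are joined by a new edge -/
  i : Fin 5
  /-- the larger of the two vertices that are joined by a new edge -/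
  j : Fin 5
  /-- the orientation -/
  ε : Bool
  lt : i < j
  not_bump₀ : ¬ (i = 0 ∧ j = 1)
  not_bump₁ : ¬ (i = 3 ∧ j = 4)

namespace MPMove

/-- Whether the tetrahedron opposite to `k` is one of the two on the left side of the move. -/
def isLeft (m : MPMove) (k : Fin 5) : Bool := k == m.i || k == m.j

/-- The ends at which the left (and the right) side of the move is entered. They are named by the
edges of the closed diagram on the boundary of the `4`-simplex that run from the left part to the
right part; in the left side of the move, all orientations are opposite to those in this diagram. -/
abbrev In (m : MPMove) : Type :=
  {h : Fin 5 × Strand // m.isLeft h.1 = true ∧ m.isLeft (Simplex.next m.ε h).1 = false}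

/-- The ends at which the left (and the right) side of the move is left. -/
abbrev Out (m : MPMove) : Type :=
  {h : Fin 5 × Strand // m.isLeft h.1 = false ∧ m.isLeft (Simplex.next m.ε h).1 = true}

/-- The diagram with two crossings before the MP move. -/
def left (m : MPMove) : OGraph m.In m.Out where
  V := {k // m.isLeft k = true}
  fin := inferInstance
  pos k := !(Simplex.sgn m.ε k.1)
  next := (Simplex.cut (Simplex.next m.ε) m.isLeft true).symm

/-- The diagram with three crossings after the MP move. -/
def right (m : MPMove) : OGraph m.In m.Out where
  V := {k // m.isLeft k = false}
  fin := inferInstance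
  pos k := Simplex.sgn m.ε k.1
  next := Simplex.cut (Simplex.next m.ε) m.isLeft false

/-- `Γ'` is obtained from `Γ` by the MP move `m`. -/
def Move (m : MPMove) {I O : Type} (Γ Γ' : OGraph I O) : Prop :=
  OGraph.LocalMove m.left m.right Γ Γ'

end MPMove

/-! ### The primary MP move

It relates two diagrams on three parallel strands `0`, `1`, `2`, all of whose crossings are positive:
`S₂₃ S₁₂ = S₁₂ S₁₃ S₂₃`. The strand with the smaller number is always the over strand. -/

namespace PrimaryMP

/-- On the left side, the crossing `0` is between the strands `1`, `2`, and the crossing `1`, which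
comes after it, is between the strands `0`, `1`. -/
def left : OGraph (Fin 3) (Fin 3) where
  V := Fin 2
  fin := inferInstance
  pos _ := true
  next :=
    { toFun := fun
        | Sum.inr 0 => Sum.inl (1, Strand.over)
        | Sum.inl (1, Strand.over) => Sum.inr 0
        | Sum.inr 1 => Sum.inl (0, Strand.over)
        | Sum.inl (0, Strand.over) => Sum.inl (1, Strand.under)
        | Sum.inl (1, Strand.under) => Sum.inr 1
        | Sum.inr 2 => Sum.inl (0, Strand.under)
        | Sum.inl (0, Strand.under) => Sum.inr 2
      invFun := fun
        | Sum.inr 0 => Sum.inl (1, Strand.over)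
        | Sum.inl (1, Strand.over) => Sum.inr 0
        | Sum.inr 1 => Sum.inl (1, Strand.under)
        | Sum.inl (1, Strand.under) => Sum.inl (0, Strand.over)
        | Sum.inl (0, Strand.over) => Sum.inr 1
        | Sum.inr 2 => Sum.inl (0, Strand.under)
        | Sum.inl (0, Strand.under) => Sum.inr 2
      left_inv := by unfold Function.LeftInverse; decide
      right_inv := by unfold Function.RightInverse Function.LeftInverse; decide }

/-- On the right side, the crossings `0`, `1`, `2` are, in this order, between the strands `0`, `1`,
between the strands `0`, `2`, and between the strands `1`, `2`. -/
def right : OGraph (Fin 3) (Fin 3) where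
  V := Fin 3
  fin := inferInstance
  pos _ := true
  next :=
    { toFun := fun
        | Sum.inr 0 => Sum.inl (0, Strand.over)
        | Sum.inl (0, Strand.over) => Sum.inl (1, Strand.over)
        | Sum.inl (1, Strand.over) => Sum.inr 0
        | Sum.inr 1 => Sum.inl (0, Strand.under)
        | Sum.inl (0, Strand.under) => Sum.inl (2, Strand.over)
        | Sum.inl (2, Strand.over) => Sum.inr 1
        | Sum.inr 2 => Sum.inl (1, Strand.under)
        | Sum.inl (1, Strand.under) => Sum.inl (2, Strand.under)
        | Sum.inl (2, Strand.under) => Sum.inr 2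
      invFun := fun
        | Sum.inr 0 => Sum.inl (1, Strand.over)
        | Sum.inl (1, Strand.over) => Sum.inl (0, Strand.over)
        | Sum.inl (0, Strand.over) => Sum.inr 0
        | Sum.inr 1 => Sum.inl (2, Strand.over)
        | Sum.inl (2, Strand.over) => Sum.inl (0, Strand.under)
        | Sum.inl (0, Strand.under) => Sum.inr 1
        | Sum.inr 2 => Sum.inl (2, Strand.under)
        | Sum.inl (2, Strand.under) => Sum.inl (1, Strand.under)
        | Sum.inl (1, Strand.under) => Sum.inr 2
      left_inv := by unfold Function.LeftInverse; decide
      right_inv := by unfold Function.RightInverse Function.LeftInverse; decide }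

/-- `Γ'` is obtained from `Γ` by the primary MP move. -/
def Move {I O : Type} (Γ Γ' : OGraph I O) : Prop := OGraph.LocalMove left right Γ Γ'

end PrimaryMP

/-! ### Local pure sliding moves -/

/-- A local pure sliding move: a pure sliding move on the left side of an MP move `base`, whose
condition holds in the circuit diagram of this local diagram with two crossings already, and that is
the first move in a decomposition `base = N⁻¹ ∘ (pure sliding move)` with an MP move `N`. -/
structure LocalPSMove where
  base : MPMove
  kind : PSKind
  l : base.left.Edge
  r : base.left.Edge
  canSlide : base.left.CanSlide kind l r
  completes : ∃ N : MPMove, N.Move base.right (base.left.slide kind l r)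

namespace LocalPSMove

/-- `Γ'` is obtained from `Γ` by the local pure sliding move `x`. -/
def Move (x : LocalPSMove) {I O : Type} (Γ Γ' : OGraph I O) : Prop :=
  OGraph.LocalMove x.base.left (x.base.left.slide x.kind x.l x.r) Γ Γ'

end LocalPSMove

/-- `Γ` and `Γ'` are related by a sequence of moves, each of which is the move `B`, a move from the
set `A` of local pure sliding moves, or the inverse of one of these. -/
def Derivable (B : ∀ {I O : Type}, OGraph I O → OGraph I O → Prop) (A : Set LocalPSMove)
    {I O : Type} (Γ Γ' : OGraph I O) : Prop :=
  Relation.EqvGen (fun Δ Δ' : OGraph I O => B Δ Δ' ∨ ∃ x ∈ A, x.Move Δ Δ') Γ Γ'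

namespace OGraph

/-!
Performing an MP move `M` amounts to performing a pure sliding move `x` on its two-crossing side and
then the inverse of another MP move `N`: the three-crossing side of `M` contains the two-crossing
side of `N`, and replacing it by the other side of `N` gives the slid diagram. So `M` can be derived
from `x` and `N`. Consider the directed graph with the 16 MP moves as vertices and an arrow from `M`
to `N`, labelled by `x`, for each such decomposition that we use. One arrow from each MP move gives
two directed cycles of length 8, and two more arrows, one in each direction, lead from one cycle to
the other. These 18 arrows make the graph strongly connected, hence it has a spanning tree directed
towards any given root. The 15 labels on this tree, together with the root, give all MP moves.
-/

theorem exists_equiv_of_image_range_eq {A B X Y : Type*} {σ : A → X} {τ : B → Y}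
    (F : X ≃ Y) (hσ : σ.Injective) (hτ : τ.Injective) (h : F '' Set.range σ = Set.range τ) :
    ∃ e : A ≃ B, ∀ a, F (σ a) = τ (e a) :=
  ⟨(Equiv.ofInjective σ hσ).trans
      ((F.image _).trans ((Equiv.setCongr h).trans (Equiv.ofInjective τ hτ).symm)),
    fun a => by simp [Equiv.apply_ofInjective_symm]⟩

variable {I O J Q : Type}

/-! ### Gluing proper diagrams -/

/-- A diagram is proper if every strand through it has a crossing. These are the diagrams for which
gluing into a context is well behaved, since an edge of the context is then prolonged at most once
at each of its two ends. -/
def Proper (T : OGraph J Q) : Prop := ∀ j, (T.next (Sum.inr j)).isLeft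

namespace Proper

variable {T : OGraph J Q} (hT : T.Proper)

include hT in
theorem isLeft_next_symm (q : Q) : (T.next.symm (Sum.inr q)).isLeft := by
  rcases h : T.next.symm (Sum.inr q) with w | j
  · rfl
  · have hj := hT j
    rw [(Equiv.symm_apply_eq _).1 h |>.symm] at hj
    cases hj

/-- The first half-edge at a crossing of `T` that is met when `T` is entered at the end `j`. -/
def entry (j : J) : T.V × Strand := (T.next (Sum.inr j)).getLeft (hT j)

/-- The last half-edge at a crossing of `T` that is met before `T` is left at the end `q`. -/
def exit (q : Q) : T.V × Strand := (T.next.symm (Sum.inr q)).getLeft (hT.isLeft_next_symm q)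

theorem next_inr (j : J) : T.next (Sum.inr j) = Sum.inl (hT.entry j) :=
  (Sum.inl_getLeft _ _).symm

theorem next_exit (q : Q) : T.next (Sum.inl (hT.exit q)) = Sum.inr q := by
  rw [exit, Sum.inl_getLeft, Equiv.apply_symm_apply]

theorem next_inl_eq_inr_iff {w : T.V × Strand} {q : Q} :
    T.next (Sum.inl w) = Sum.inr q ↔ w = hT.exit q := by
  rw [← hT.next_exit q, T.next.injective.eq_iff, Sum.inl.injEq]

theorem next_inr_eq_inl_iff {j : J} {w : T.V × Strand} :
    T.next (Sum.inr j) = Sum.inl w ↔ w = hT.entry j := by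
  rw [hT.next_inr, Sum.inl.injEq, eq_comm]

theorem entry_injective : hT.entry.Injective := fun j j' h =>
  Sum.inr_injective (T.next.injective (by rw [hT.next_inr, hT.next_inr, h]))

theorem exit_injective : hT.exit.Injective := fun q q' h =>
  Sum.inr_injective (by rw [← hT.next_exit, ← hT.next_exit, h])

theorem notMem_range_exit {w w' : T.V × Strand} (h : T.next (Sum.inl w) = Sum.inl w') :
    w ∉ Set.range hT.exit := by
  rintro ⟨q, rfl⟩
  rw [hT.next_exit] at h
  cases h

theorem notMem_range_entry {w w' : T.V × Strand} (h : T.next (Sum.inl w) = Sum.inl w') :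
    w' ∉ Set.range hT.entry := by
  rintro ⟨j, rfl⟩
  rw [← hT.next_inr] at h
  cases T.next.injective h

theorem exists_innerEquiv :
    ∃ e : ↥(Set.range hT.exit)ᶜ ≃ ↥(Set.range hT.entry)ᶜ,
      ∀ w : ↥(Set.range hT.exit)ᶜ, T.next (Sum.inl w.1) = Sum.inl (e w).1 := by
  refine exists_equiv_of_image_range_eq T.next
    (σ := fun w : ↥(Set.range hT.exit)ᶜ => Sum.inl w.1)
    (τ := fun w : ↥(Set.range hT.entry)ᶜ => Sum.inl w.1)
    (Sum.inl_injective.comp Subtype.val_injective)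
    (Sum.inl_injective.comp Subtype.val_injective) (Set.Subset.antisymm ?_ ?_)
  · rintro _ ⟨_, ⟨⟨w, hw⟩, rfl⟩, rfl⟩
    rcases h : T.next (Sum.inl w) with w' | q
    · exact ⟨⟨w', hT.notMem_range_entry h⟩, rfl⟩
    · exact absurd ⟨q, (hT.next_inl_eq_inr_iff.1 h).symm⟩ hw
  · rintro _ ⟨⟨w', hw'⟩, rfl⟩
    obtain ⟨w | j, h⟩ := T.next.surjective (Sum.inl w')
    · exact ⟨_, ⟨⟨w, hT.notMem_range_exit h⟩, rfl⟩, h⟩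
    · exact absurd ⟨j, (hT.next_inr_eq_inl_iff.1 h).symm⟩ hw'

end Proper

section Attach

variable {E H K V X : Type}

/-- The image of a half-edge under a map `f` of crossings, among the half-edges and the ends `E` of
the target. -/
def mapHalfEdge (f : V → X) (w : V × Strand) : (X × Strand) ⊕ E := Sum.inl (f w.1, w.2)

/-- The place, in a diagram with crossings `X`, of a half-edge or end of a context with crossings
`K`: the ends `E` of the context are ends of the whole diagram, and its ends `H` at the hole are
attached to the half-edges `p` of the part in the hole, which has the crossings `V`. It is used both
for the starts of edges (with `p` the exits of the part) and for their arrivals (with its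
entries). -/
def attach (ι : K ⊕ V → X) (p : H → V × Strand) :
    (K × Strand) ⊕ (H ⊕ E) → (X × Strand) ⊕ E
  | Sum.inl w => mapHalfEdge (ι ∘ Sum.inl) w
  | Sum.inr (Sum.inl h) => mapHalfEdge (ι ∘ Sum.inr) (p h)
  | Sum.inr (Sum.inr e) => Sum.inr e

variable {f : V → X} {ι : K ⊕ V → X} {p : H → V × Strand}

theorem mapHalfEdge_injective (hf : f.Injective) :
    (mapHalfEdge f : _ → (X × Strand) ⊕ E).Injective := by
  rintro ⟨v, s⟩ ⟨v', s'⟩ h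
  simpa only [mapHalfEdge, Sum.inl.injEq, Prod.mk.injEq, hf.eq_iff] using h

theorem mapHalfEdge_inl_ne_inr (hι : ι.Injective) (k : K × Strand) (w : V × Strand) :
    (mapHalfEdge (ι ∘ Sum.inl) k : (X × Strand) ⊕ E) ≠ mapHalfEdge (ι ∘ Sum.inr) w := by
  simp [mapHalfEdge, hι.eq_iff]

theorem attach_injective (hι : ι.Injective) (hp : p.Injective) :
    (attach ι p : _ → (X × Strand) ⊕ E).Injective := by
  have hl := mapHalfEdge_injective (E := E) (hι.comp Sum.inl_injective)
  have hr := mapHalfEdge_injective (E := E) (hι.comp Sum.inr_injective)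
  rintro (k | h | e) (k' | h' | e') heq
  · rw [hl heq]
  · exact absurd heq (mapHalfEdge_inl_ne_inr hι k (p h'))
  · cases heq
  · exact absurd heq.symm (mapHalfEdge_inl_ne_inr hι k' (p h))
  · rw [hp (hr heq)]
  · cases heq
  · cases heq
  · cases heq
  · rw [Sum.inr_injective heq]

theorem compl_range_attach (hι : ι.Bijective) :
    (Set.range (attach ι p : _ → (X × Strand) ⊕ E))ᶜ =
      mapHalfEdge (ι ∘ Sum.inr) '' (Set.range p)ᶜ := by
  apply Set.Subset.antisymm
  · rintro (⟨x, s⟩ | e) hx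
    · obtain ⟨k | v, rfl⟩ := hι.surjective x
      · exact absurd ⟨Sum.inl (k, s), rfl⟩ hx
      · refine ⟨(v, s), ?_, rfl⟩
        rintro ⟨h, hv⟩
        exact hx ⟨Sum.inr (Sum.inl h), congrArg (mapHalfEdge (ι ∘ Sum.inr)) hv⟩
    · exact absurd ⟨Sum.inr (Sum.inr e), rfl⟩ hx
  · rintro _ ⟨w, hw, rfl⟩ ⟨k | h | e, heq⟩
    · exact mapHalfEdge_inl_ne_inr hι.injective k w heq
    · exact hw ⟨h, mapHalfEdge_injective (hι.injective.comp Sum.inr_injective) heq⟩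
    · cases heq

theorem sumElim_attach_bijective (hι : ι.Bijective) (hp : p.Injective) :
    (Sum.elim (attach ι p) fun w : ↥(Set.range p)ᶜ =>
      (mapHalfEdge (ι ∘ Sum.inr) w : (X × Strand) ⊕ E)).Bijective := by
  have hcompl := compl_range_attach (E := E) (p := p) hι
  constructor
  · refine (attach_injective hι.injective hp).sumElim
      ((mapHalfEdge_injective (hι.injective.comp Sum.inr_injective)).comp
        Subtype.val_injective) fun a w h => ?_
    exact hcompl.superset ⟨w, w.2, rfl⟩ ⟨a, h⟩
  · intro x
    by_cases hx : x ∈ Set.range (attach ι p)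
    · obtain ⟨a, rfl⟩ := hx
      exact ⟨Sum.inl a, rfl⟩
    · obtain ⟨w, hw, rfl⟩ := hcompl.subset hx
      exact ⟨Sum.inr ⟨w, hw⟩, rfl⟩

end Attach

section Gluing

variable {T : OGraph J Q} {Γ : OGraph I O}

/-- `T` is a part of `Γ`, with crossings given by `f`: the signs of its crossings and the edges
between them are the same in `Γ`. -/
structure IsPart (T : OGraph J Q) (Γ : OGraph I O) (f : T.V → Γ.V) : Prop where
  pos : ∀ v, Γ.pos (f v) = T.pos v
  next : ∀ w w', T.next (Sum.inl w) = Sum.inl w' → Γ.next (mapHalfEdge f w) = mapHalfEdge f w'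

theorem IsPart.image_compl_range_exit {f : T.V → Γ.V} (h : T.IsPart Γ f) (hT : T.Proper) :
    Γ.next '' (mapHalfEdge f '' (Set.range hT.exit)ᶜ) = mapHalfEdge f '' (Set.range hT.entry)ᶜ := by
  obtain ⟨e, he⟩ := hT.exists_innerEquiv
  apply Set.Subset.antisymm
  · rintro _ ⟨_, ⟨w, hw, rfl⟩, rfl⟩
    exact ⟨e ⟨w, hw⟩, (e ⟨w, hw⟩).2, (h.next _ _ (he ⟨w, hw⟩)).symm⟩
  · rintro _ ⟨w', hw', rfl⟩
    obtain ⟨w, hw⟩ := e.surjective ⟨w', hw'⟩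
    exact ⟨_, ⟨w, w.2, rfl⟩, h.next _ _ (by rw [he, hw])⟩

theorem IsPart.exists_context {K : Type} {ι : K ⊕ T.V → Γ.V} (h : T.IsPart Γ (ι ∘ Sum.inr))
    (hT : T.Proper) (hι : ι.Bijective) :
    ∃ e : (K × Strand) ⊕ (Q ⊕ I) ≃ (K × Strand) ⊕ (J ⊕ O),
      ∀ a, Γ.next (attach ι hT.exit a) = attach ι hT.entry (e a) := by
  refine exists_equiv_of_image_range_eq Γ.next (attach_injective hι.injective hT.exit_injective)
    (attach_injective hι.injective hT.entry_injective) (compl_injective ?_)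
  rw [← Set.image_compl_eq Γ.next.bijective, compl_range_attach hι, compl_range_attach hι,
    h.image_compl_range_exit hT]

/-- `Γ` is obtained by putting the proper diagram `T` into the hole of the context `C`, where `ι`
identifies the crossings of `Γ` with those of `C` and of `T`. -/
structure IsGluedAlong (C : OGraph (Q ⊕ I) (J ⊕ O)) (hT : T.Proper) (Γ : OGraph I O)
    (ι : C.V ⊕ T.V → Γ.V) : Prop where
  bij : ι.Bijective
  pos : ∀ v, Γ.pos (ι (Sum.inl v)) = C.pos v
  part : T.IsPart Γ (ι ∘ Sum.inr)
  next : ∀ a, Γ.next (attach ι hT.exit a) = attach ι hT.entry (C.next a)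

theorem Proper.isGlued_iff (hT : T.Proper) {C : OGraph (Q ⊕ I) (J ⊕ O)} :
    IsGlued C T Γ ↔ ∃ ι, IsGluedAlong C hT Γ ι := by
  constructor
  · rintro ⟨ι, hC, hpos, hnext, hglue⟩
    refine ⟨ι, ι.bijective, hC, ⟨hpos, fun w w' => hnext _ _ _ _⟩, fun a => hglue a _ _ ?_ ?_⟩
    · rcases a with k | q | i
      exacts [rfl, ⟨_, _, hT.next_exit q, rfl⟩, rfl]
    · rcases C.next a with k | j | o
      exacts [rfl, ⟨_, _, hT.next_inr j, rfl⟩, rfl]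
  · rintro ⟨ι, hι, hC, hpart, hnext⟩
    refine ⟨Equiv.ofBijective ι hι, hC, hpart.pos, fun v s w t => hpart.next (v, s) (w, t),
      fun a x y hx hy => ?_⟩
    have hxa : x = attach ι hT.exit a := by
      rcases a with k | q | i
      · exact hx
      · obtain ⟨v, s, hv, rfl⟩ := hx
        exact congrArg (mapHalfEdge (ι ∘ Sum.inr)) (hT.next_inl_eq_inr_iff.1 hv)
      · exact hx
    have hya : y = attach ι hT.entry (C.next a) := by
      rcases hb : C.next a with k | j | o <;> rw [hb] at hy
      · exact hy
      · obtain ⟨v, s, hv, rfl⟩ := hy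
        exact congrArg (mapHalfEdge (ι ∘ Sum.inr)) (hT.next_inr_eq_inl_iff.1 hv)
      · exact hy
    rw [hxa, hya, hnext]

theorem Proper.exists_isGlued (hT : T.Proper) (C : OGraph (Q ⊕ I) (J ⊕ O)) :
    ∃ Γ : OGraph I O, IsGlued C T Γ := by
  obtain ⟨e, he⟩ := hT.exists_innerEquiv
  let start := Equiv.ofBijective _
    (sumElim_attach_bijective (K := C.V) (E := I) Function.bijective_id hT.exit_injective)
  let arrival := Equiv.ofBijective _
    (sumElim_attach_bijective (K := C.V) (E := O) Function.bijective_id hT.entry_injective)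
  let next := start.symm.trans ((C.next.sumCongr e).trans arrival)
  have next_start : ∀ x, next (start x) = arrival (C.next.sumCongr e x) := by simp [next]
  have hfin : Finite (C.V ⊕ T.V) :=
    have := C.fin
    have := T.fin
    inferInstance
  refine ⟨⟨C.V ⊕ T.V, hfin, Sum.elim C.pos T.pos, next⟩, hT.isGlued_iff.2
    ⟨id, Function.bijective_id, fun _ => rfl, ⟨fun _ => rfl, fun w w' h => ?_⟩,
      fun a => next_start (Sum.inl a)⟩⟩
  have hw' : w' = e ⟨w, hT.notMem_range_exit h⟩ := Sum.inl_injective (h.symm.trans (he ⟨w, _⟩))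
  rw [hw']
  exact next_start (Sum.inr ⟨w, _⟩)

end Gluing

/-! ### Local moves as replacements of parts -/

section Replacement

variable {L R : OGraph J Q} {hL : L.Proper} {hR : R.Proper} {Γ Γ' : OGraph I O} {K : Type}

/-- `Γ'` arises from `Γ` when the part `L` is replaced by `R`, where the other crossings of both
diagrams are indexed by `K`. This describes a local move without mentioning its context: `next` says
that the edges of `Γ` and `Γ'` outside `L` and `R` come from the same edges of a context. -/
structure IsReplacement (hL : L.Proper) (hR : R.Proper) (Γ Γ' : OGraph I O)
    (ι : K ⊕ L.V → Γ.V) (ι' : K ⊕ R.V → Γ'.V) : Prop where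
  bij : ι.Bijective
  bij' : ι'.Bijective
  pos : ∀ k, Γ'.pos (ι' (Sum.inl k)) = Γ.pos (ι (Sum.inl k))
  part : L.IsPart Γ (ι ∘ Sum.inr)
  part' : R.IsPart Γ' (ι' ∘ Sum.inr)
  next : ∀ a, ∃ b, Γ.next (attach ι hL.exit a) = attach ι hL.entry b ∧
    Γ'.next (attach ι' hR.exit a) = attach ι' hR.entry b

theorem LocalMove.exists_isReplacement (h : LocalMove L R Γ Γ') (hL : L.Proper) (hR : R.Proper) :
    ∃ (K : Type) (ι : K ⊕ L.V → Γ.V) (ι' : K ⊕ R.V → Γ'.V), IsReplacement hL hR Γ Γ' ι ι' := by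
  obtain ⟨C, h, h'⟩ := h
  obtain ⟨ι, h⟩ := hL.isGlued_iff.1 h
  obtain ⟨ι', h'⟩ := hR.isGlued_iff.1 h'
  exact ⟨C.V, ι, ι', h.bij, h'.bij, fun k => (h'.pos k).trans (h.pos k).symm, h.part, h'.part,
    fun a => ⟨C.next a, h.next a, h'.next a⟩⟩

theorem IsReplacement.localMove {ι : K ⊕ L.V → Γ.V} {ι' : K ⊕ R.V → Γ'.V}
    (h : IsReplacement hL hR Γ Γ' ι ι') : LocalMove L R Γ Γ' := by
  obtain ⟨e, he⟩ := h.part.exists_context hL h.bij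
  have he' : ∀ a, Γ'.next (attach ι' hR.exit a) = attach ι' hR.entry (e a) := fun a => by
    obtain ⟨b, hb, hb'⟩ := h.next a
    rw [hb', attach_injective h.bij.injective hL.entry_injective (hb.symm.trans (he a))]
  have hK : Finite K :=
    have := Γ.fin
    Finite.of_injective _ (h.bij.injective.comp Sum.inl_injective)
  exact ⟨⟨K, hK, Γ.pos ∘ ι ∘ Sum.inl, e⟩,
    hL.isGlued_iff.2 ⟨ι, h.bij, fun _ => rfl, h.part, he⟩,
    hR.isGlued_iff.2 ⟨ι', h.bij', h.pos, h.part', he'⟩⟩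

end Replacement

section Nested

variable {J' Q' K₁ K₂ : Type}

/-- If the crossings of a part are indexed by `K₁ ⊕ V` and those of the whole diagram by `K₂` and
the crossings of the part, the latter are indexed by `(K₂ ⊕ K₁) ⊕ V`. -/
def nest {V W X : Type} (ι₂ : K₂ ⊕ W → X) (ι₁ : K₁ ⊕ V → W) : (K₂ ⊕ K₁) ⊕ V → X :=
  ι₂ ∘ Sum.map id ι₁ ∘ Equiv.sumAssoc K₂ K₁ V

theorem nest_bijective {V W X : Type} {ι₂ : K₂ ⊕ W → X} {ι₁ : K₁ ⊕ V → W}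
    (h₂ : ι₂.Bijective) (h₁ : ι₁.Bijective) : (nest ι₂ ι₁).Bijective :=
  h₂.comp ((Sum.map_bijective.2 ⟨Function.bijective_id, h₁⟩).comp (Equiv.bijective _))

theorem exists_attach_nest {E E' H V V' W W' X X' : Type} {ι₁ : K₁ ⊕ V → W} {ι₁' : K₁ ⊕ V' → W'}
    {p : H → V × Strand} {p' : H → V' × Strand} {u : W × Strand} {u' : W' × Strand}
    {a : (K₁ × Strand) ⊕ (H ⊕ E')} (h : attach ι₁ p a = Sum.inl u)
    (h' : attach ι₁' p' a = Sum.inl u') (ι₂ : K₂ ⊕ W → X) (ι₂' : K₂ ⊕ W' → X') :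
    ∃ b : ((K₂ ⊕ K₁) × Strand) ⊕ (H ⊕ E),
      mapHalfEdge (ι₂ ∘ Sum.inr) u = attach (nest ι₂ ι₁) p b ∧
      mapHalfEdge (ι₂' ∘ Sum.inr) u' = attach (nest ι₂' ι₁') p' b := by
  rcases a with ⟨k, s⟩ | q | e
  · cases h
    cases h'
    exact ⟨Sum.inl (Sum.inr k, s), rfl, rfl⟩
  · cases h
    cases h'
    exact ⟨Sum.inr (Sum.inl q), rfl, rfl⟩
  · cases h

namespace IsReplacement

variable {A B : OGraph J' Q'} {T T' : OGraph J Q} {Γ Γ' : OGraph I O} {hA : A.Proper}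
  {hB : B.Proper} {hT : T.Proper} {hT' : T'.Proper} {ι₁ : K₁ ⊕ A.V → T.V} {ι₁' : K₁ ⊕ B.V → T'.V}
  {ι₂ : K₂ ⊕ T.V → Γ.V} {ι₂' : K₂ ⊕ T'.V → Γ'.V}

theorem exists_next_outer (h₁ : IsReplacement hA hB T T' ι₁ ι₁')
    (h₂ : IsReplacement hT hT' Γ Γ' ι₂ ι₂') (a : (K₂ × Strand) ⊕ (Q ⊕ I)) :
    ∃ b, Γ.next (attach ι₂ hT.exit a) = attach (nest ι₂ ι₁) hA.entry b ∧
      Γ'.next (attach ι₂' hT'.exit a) = attach (nest ι₂' ι₁') hB.entry b := by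
  obtain ⟨b, hb, hb'⟩ := h₂.next a
  rw [hb, hb']
  rcases b with ⟨k, s⟩ | j | o
  · exact ⟨Sum.inl (Sum.inl k, s), rfl, rfl⟩
  · obtain ⟨c, hc, hc'⟩ := h₁.next (Sum.inr (Sum.inr j))
    exact exists_attach_nest (hc.symm.trans (hT.next_inr j)) (hc'.symm.trans (hT'.next_inr j)) _ _
  · exact ⟨Sum.inr (Sum.inr o), rfl, rfl⟩

theorem exists_next_inner (h₁ : IsReplacement hA hB T T' ι₁ ι₁')
    (h₂ : IsReplacement hT hT' Γ Γ' ι₂ ι₂') {a : (K₁ × Strand) ⊕ (Q' ⊕ J)} {w : T.V × Strand}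
    {w' : T'.V × Strand} (h : attach ι₁ hA.exit a = Sum.inl w)
    (h' : attach ι₁' hB.exit a = Sum.inl w') :
    ∃ b, Γ.next (mapHalfEdge (ι₂ ∘ Sum.inr) w) = attach (nest ι₂ ι₁) hA.entry b ∧
      Γ'.next (mapHalfEdge (ι₂' ∘ Sum.inr) w') = attach (nest ι₂' ι₁') hB.entry b := by
  obtain ⟨b, hb, hb'⟩ := h₁.next a
  rw [h] at hb
  rw [h'] at hb'
  by_cases hq : ∃ q, b = Sum.inr (Sum.inr q)
  · obtain ⟨q, rfl⟩ := hq
    rw [hT.next_inl_eq_inr_iff.1 hb, hT'.next_inl_eq_inr_iff.1 hb']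
    exact h₁.exists_next_outer h₂ (Sum.inr (Sum.inl q))
  · obtain ⟨u, u', hu, hu'⟩ :
        ∃ u u', attach ι₁ hA.entry b = Sum.inl u ∧ attach ι₁' hB.entry b = Sum.inl u' := by
      rcases b with k | j | q
      exacts [⟨_, _, rfl, rfl⟩, ⟨_, _, rfl, rfl⟩, absurd ⟨q, rfl⟩ hq]
    rw [h₂.part.next _ _ (hb.trans hu), h₂.part'.next _ _ (hb'.trans hu')]
    exact exists_attach_nest hu hu' _ _

theorem nest (h₁ : IsReplacement hA hB T T' ι₁ ι₁') (h₂ : IsReplacement hT hT' Γ Γ' ι₂ ι₂') :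
    IsReplacement hA hB Γ Γ' (nest ι₂ ι₁) (nest ι₂' ι₁') where
  bij := nest_bijective h₂.bij h₁.bij
  bij' := nest_bijective h₂.bij' h₁.bij'
  pos
    | Sum.inl k => h₂.pos k
    | Sum.inr k => (h₂.part'.pos _).trans ((h₁.pos k).trans (h₂.part.pos _).symm)
  part := ⟨fun v => (h₂.part.pos _).trans (h₁.part.pos v),
    fun _ _ h => h₂.part.next _ _ (h₁.part.next _ _ h)⟩
  part' := ⟨fun v => (h₂.part'.pos _).trans (h₁.part'.pos v),
    fun _ _ h => h₂.part'.next _ _ (h₁.part'.next _ _ h)⟩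
  next
    | Sum.inl (Sum.inl k, s) => h₁.exists_next_outer h₂ (Sum.inl (k, s))
    | Sum.inl (Sum.inr k, s) => h₁.exists_next_inner h₂ (a := Sum.inl (k, s)) rfl rfl
    | Sum.inr (Sum.inl q) => h₁.exists_next_inner h₂ (a := Sum.inr (Sum.inl q)) rfl rfl
    | Sum.inr (Sum.inr i) => h₁.exists_next_outer h₂ (Sum.inr (Sum.inr i))

end IsReplacement

theorem LocalMove.trans_part {A B : OGraph J' Q'} {T T' : OGraph J Q} {Γ Γ' : OGraph I O}
    (h₁ : LocalMove A B T T') (h₂ : LocalMove T T' Γ Γ') (hA : A.Proper) (hB : B.Proper)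
    (hT : T.Proper) (hT' : T'.Proper) : LocalMove A B Γ Γ' := by
  obtain ⟨_, _, _, h₁⟩ := h₁.exists_isReplacement hA hB
  obtain ⟨_, _, _, h₂⟩ := h₂.exists_isReplacement hT hT'
  exact (h₁.nest h₂).localMove

end Nested

/-! ### Decision procedures -/

section Decidability

variable {K : Type} {L R : OGraph J Q} {Γ Γ' : OGraph I O}

instance IsPart.decidable {f : L.V → Γ.V} [Fintype L.V] [DecidableEq L.V] [DecidableEq Q]
    [DecidableEq Γ.V] [DecidableEq O] : Decidable (L.IsPart Γ f) :=
  decidable_of_iff ((∀ v, Γ.pos (f v) = L.pos v) ∧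
      ∀ w w', L.next (Sum.inl w) = Sum.inl w' → Γ.next (mapHalfEdge f w) = mapHalfEdge f w')
    ⟨fun h => ⟨h.1, h.2⟩, fun h => ⟨h.pos, h.next⟩⟩

instance IsReplacement.decidable {hL : L.Proper} {hR : R.Proper} {ι : K ⊕ L.V → Γ.V}
    {ι' : K ⊕ R.V → Γ'.V} [Fintype K] [Fintype L.V] [Fintype R.V] [Fintype Γ.V] [Fintype Γ'.V]
    [Fintype I] [Fintype O] [Fintype J] [Fintype Q] [DecidableEq K] [DecidableEq L.V]
    [DecidableEq R.V] [DecidableEq Γ.V] [DecidableEq Γ'.V] [DecidableEq Q] [DecidableEq O] :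
    Decidable (IsReplacement hL hR Γ Γ' ι ι') :=
  decidable_of_iff (ι.Bijective ∧ ι'.Bijective ∧
      (∀ k, Γ'.pos (ι' (Sum.inl k)) = Γ.pos (ι (Sum.inl k))) ∧ L.IsPart Γ (ι ∘ Sum.inr) ∧
      R.IsPart Γ' (ι' ∘ Sum.inr) ∧
      ∀ a, ∃ b, Γ.next (attach ι hL.exit a) = attach ι hL.entry b ∧
        Γ'.next (attach ι' hR.exit a) = attach ι' hR.entry b)
    ⟨fun ⟨h₁, h₂, h₃, h₄, h₅, h₆⟩ => ⟨h₁, h₂, h₃, h₄, h₅, h₆⟩,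
      fun ⟨h₁, h₂, h₃, h₄, h₅, h₆⟩ => ⟨h₁, h₂, h₃, h₄, h₅, h₆⟩⟩

instance LineJoined.decidable [Fintype Γ.V] [DecidableEq Γ.V] [DecidableEq I]
    (x y : Γ.Edge × Fin 3) : Decidable (Γ.LineJoined x y) := by
  unfold LineJoined
  infer_instance

end Decidability

section Slide

variable (Γ : OGraph I O)

/-- The diagram `Γ.slide k l r`, constructed without choice, so that statements about it can be
decided by evaluation. -/
def slideDec [DecidableEq Γ.V] [DecidableEq I] (k : PSKind) (l r : Γ.Edge) : OGraph I O where
  V := Γ.V ⊕ Bool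
  fin :=
    have := Γ.fin
    inferInstance
  pos := Sum.elim Γ.pos id
  next :=
    ((Equiv.swap (Γ.oldEdge (if k.leftOver then l else r))
        (Sum.inl (Sum.inr (!k.overFirst), Strand.over))).trans
      (Equiv.swap (Γ.oldEdge (if k.leftOver then r else l))
        (Sum.inl (Sum.inr (!k.underFirst), Strand.under)))).trans Γ.addPair

theorem slide_eq_slideDec [DecidableEq Γ.V] [DecidableEq I] (k : PSKind) (l r : Γ.Edge) :
    Γ.slide k l r = Γ.slideDec k l r := by
  cases h : k.leftOver <;>
    · simp only [slide, slideDec, insertPair, h, if_true, Bool.false_eq_true, if_false]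
      congr!

instance [Fintype Γ.V] [DecidableEq Γ.V] [DecidableEq I] (k : PSKind) (l r : Γ.Edge) :
    Fintype (Γ.slideDec k l r).V :=
  inferInstanceAs (Fintype (Γ.V ⊕ Bool))

instance [DecidableEq Γ.V] [DecidableEq I] (k : PSKind) (l r : Γ.Edge) :
    DecidableEq (Γ.slideDec k l r).V :=
  inferInstanceAs (DecidableEq (Γ.V ⊕ Bool))

variable {Γ}

theorem Proper.insertPair (hΓ : Γ.Proper) (a b : Γ.Edge) (c d : Bool) :
    (Γ.insertPair a b c d).Proper := by
  classical
  intro j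
  have hold : (Γ.addPair (Sum.inr j)).isLeft := by simp [addPair, hΓ.next_inr]
  have hnew : ∀ e s, (Γ.addPair (Sum.inl (Sum.inr e, s))).isLeft := fun _ _ => rfl
  change (Γ.addPair (Equiv.swap _ _ (Equiv.swap _ _ (Sum.inr j)))).isLeft
  rw [Equiv.swap_apply_def (Γ.oldEdge a), Equiv.swap_apply_def]
  split_ifs <;> first | exact hold | exact hnew _ _ | simp_all

theorem Proper.slide (hΓ : Γ.Proper) (k : PSKind) (l r : Γ.Edge) : (Γ.slide k l r).Proper := by
  unfold OGraph.slide
  split_ifs <;> exact hΓ.insertPair _ _ _ _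

theorem CanSlide.of_joined {k : PSKind} {l r : Γ.Edge} (h : l ≠ r) {z : Γ.Edge × Fin 3}
    (h₁ : Γ.LineJoined (l, k.leftLine) z) (h₂ : Γ.LineJoined z (r, k.rightLine)) :
    Γ.CanSlide k l r :=
  ⟨h, .trans _ _ _ (.rel _ _ h₁) (.rel _ _ h₂)⟩

end Slide

end OGraph

/-! ### Decompositions of MP moves -/

namespace LocalPSMove

/-- The local pure sliding move `x` followed by the inverse of `n` gives the move `x.base`. -/
def CompletedBy (x : LocalPSMove) (n : MPMove) : Prop :=
  n.Move x.base.right (x.base.left.slide x.kind x.l x.r)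

end LocalPSMove

namespace MPMove

instance (m : MPMove) : Fintype m.left.V := inferInstanceAs (Fintype {k // m.isLeft k = true})

instance (m : MPMove) : Fintype m.right.V := inferInstanceAs (Fintype {k // m.isLeft k = false})

instance (m : MPMove) : DecidableEq m.left.V :=
  inferInstanceAs (DecidableEq {k // m.isLeft k = true})

instance (m : MPMove) : DecidableEq m.right.V :=
  inferInstanceAs (DecidableEq {k // m.isLeft k = false})

theorem left_proper (m : MPMove) : m.left.Proper := fun _ => rfl

theorem right_proper (m : MPMove) : m.right.Proper := fun _ => rfl

/-- The vertices of the `4`-simplex that are on the left side of neither move. In the decompositions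
of `m` by `n` there is exactly one of them. -/
abbrev Spare (m n : MPMove) : Type := {k // m.isLeft k = false ∧ n.isLeft k = false}

/-- The crossings of `m.right` are those of `n.left` and a spare one. -/
def rightIncl (m n : MPMove) (h : ∀ k, n.isLeft k = true → m.isLeft k = false) :
    Spare m n ⊕ n.left.V → m.right.V :=
  Sum.elim (fun k => ⟨k.1, k.2.1⟩) (fun k => ⟨k.1, h k.1 k.2⟩)

/-- The crossings of `n.right` are those of `m.left` and a spare one. A pure sliding move on
`m.left` adds two crossings of opposite signs: the spare ones of `m.right` and of `n.right`. -/
def slideIncl (m n : MPMove) (k : PSKind) (l r : m.left.Edge) :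
    Spare m n ⊕ n.right.V → (m.left.slideDec k l r).V :=
  Sum.elim (fun v => Sum.inr (Simplex.sgn m.ε v.1)) fun v =>
    if h : m.isLeft v.1 = true then Sum.inl ⟨v.1, h⟩ else Sum.inr !(Simplex.sgn m.ε v.1)

/-- A decidable criterion for the pure sliding move of type `k` on the edges `l` and `r` of `m.left`
to be a local pure sliding move that is completed by `n`. The two lines in the condition of the move
are required to be at most two steps apart in the circuit diagram. -/
def Decomposes (m n : MPMove) (k : PSKind) (l r : m.left.Edge) : Prop :=
  l ≠ r ∧
  (∃ z, m.left.LineJoined (l, k.leftLine) z ∧ m.left.LineJoined z (r, k.rightLine)) ∧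
  ∃ h, OGraph.IsReplacement n.left_proper n.right_proper m.right (m.left.slideDec k l r)
    (m.rightIncl n h) (m.slideIncl n k l r)

instance (m n : MPMove) (k : PSKind) (l r : m.left.Edge) : Decidable (m.Decomposes n k l r) := by
  have (h : ∀ k, n.isLeft k = true → m.isLeft k = false) :
      Decidable (OGraph.IsReplacement n.left_proper n.right_proper m.right (m.left.slideDec k l r)
        (m.rightIncl n h) (m.slideIncl n k l r)) :=
    OGraph.IsReplacement.decidable
  unfold Decomposes
  infer_instance

theorem Decomposes.exists_localPSMove {m n : MPMove} {k : PSKind} {l r : m.left.Edge}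
    (h : m.Decomposes n k l r) : ∃ x : LocalPSMove, x.base = m ∧ x.kind = k ∧ x.CompletedBy n := by
  obtain ⟨hlr, ⟨z, hlz, hzr⟩, _, hrep⟩ := h
  have hmove : n.Move m.right (m.left.slide k l r) := by
    rw [OGraph.slide_eq_slideDec]
    exact hrep.localMove
  exact ⟨⟨m, k, l, r, .of_joined hlr hlz hzr, n, hmove⟩, rfl, rfl, hmove⟩

end MPMove

theorem LocalPSMove.CompletedBy.exists_move {x : LocalPSMove} {n : MPMove} (h : x.CompletedBy n)
    {I O : Type} {Γ Γ' : OGraph I O} (hΓ : x.base.Move Γ Γ') :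
    ∃ Δ, x.Move Γ Δ ∧ n.Move Γ' Δ := by
  obtain ⟨C, hL, hR⟩ := hΓ
  have hs := x.base.left_proper.slide x.kind x.l x.r
  obtain ⟨Δ, hΔ⟩ := hs.exists_isGlued C
  exact ⟨Δ, ⟨C, hL, hΔ⟩, OGraph.LocalMove.trans_part h ⟨C, hR, hΔ⟩ n.left_proper n.right_proper
    x.base.right_proper hs⟩

theorem Derivable.of_completedBy {B : ∀ {I O : Type}, OGraph I O → OGraph I O → Prop}
    {A : Set LocalPSMove} {x : LocalPSMove} {n : MPMove} (hx : x ∈ A) (h : x.CompletedBy n)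
    (hn : ∀ (I O : Type) (Γ Γ' : OGraph I O), n.Move Γ Γ' → Derivable B A Γ Γ') {I O : Type}
    {Γ Γ' : OGraph I O} (hΓ : x.base.Move Γ Γ') : Derivable B A Γ Γ' := by
  obtain ⟨Δ, hΓΔ, hΔ⟩ := h.exists_move hΓ
  exact .trans _ Δ _ (.rel _ _ (.inr ⟨x, hx, hΓΔ⟩)) (.symm _ _ (hn I O _ _ hΔ))

/-! ### The graph of decompositions -/

namespace MPMove

/-- An MP move is given by its two vertices and its orientation. -/
def equivTriple : MPMove ≃ {p : Fin 5 × Fin 5 × Bool //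
    p.1 < p.2.1 ∧ ¬(p.1 = 0 ∧ p.2.1 = 1) ∧ ¬(p.1 = 3 ∧ p.2.1 = 4)} where
  toFun m := ⟨(m.i, m.j, m.ε), m.lt, m.not_bump₀, m.not_bump₁⟩
  invFun p := ⟨p.1.1, p.1.2.1, p.1.2.2, p.2.1, p.2.2.1, p.2.2.2⟩

instance : DecidableEq MPMove := equivTriple.decidableEq

instance : Fintype MPMove := Fintype.ofEquiv _ equivTriple.symm

theorem card_eq : Nat.card MPMove = 16 := by
  rw [Nat.card_eq_fintype_card]
  decide +kernel

/-- The target of the arrow in the cycle through an MP move. It has the opposite orientation, and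
its vertices go through `02 → 14 → 23 → 04 → 12 → 03 → 24 → 13 → 02`. -/
def succ (m : MPMove) : MPMove :=
  match m.i, m.j with
  | 0, 2 => ⟨1, 4, !m.ε, by decide, by decide, by decide⟩
  | 1, 3 => ⟨0, 2, !m.ε, by decide, by decide, by decide⟩
  | 2, 4 => ⟨1, 3, !m.ε, by decide, by decide, by decide⟩
  | 0, 3 => ⟨2, 4, !m.ε, by decide, by decide, by decide⟩
  | 1, 2 => ⟨0, 3, !m.ε, by decide, by decide, by decide⟩
  | 0, 4 => ⟨1, 2, !m.ε, by decide, by decide, by decide⟩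
  | 2, 3 => ⟨0, 4, !m.ε, by decide, by decide, by decide⟩
  | _, _ => ⟨2, 3, !m.ε, by decide, by decide, by decide⟩

/-- The type of the pure sliding move in the decomposition of `m` that is completed by `m.succ`. -/
def succKind (m : MPMove) : PSKind :=
  match m.i, m.j with
  | 0, 2 => .I
  | 0, 3 => .I
  | 1, 3 => .II
  | 2, 4 => .II
  | 0, 4 => .III
  | 1, 4 => .III
  | _, _ => .IV

/-- An invariant of the two cycles, which tells them apart. -/
def cycleIndex (m : MPMove) : Bool := (m.i == 2 || m.j == 2) == m.ε

end MPMove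

/-- The arrows of the graph of decompositions of MP moves: those in the two cycles, and the two
bridges between the cycles. -/
inductive Arrow
  | cycle (m : MPMove)
  | bridge (ε : Bool)
  deriving DecidableEq, Fintype

namespace Arrow

/-- The MP move that is decomposed. -/
def source : Arrow → MPMove
  | cycle m => m
  | bridge ε => ⟨1, 4, ε, by decide, by decide, by decide⟩

/-- The MP move whose inverse completes the decomposition. -/
def target : Arrow → MPMove
  | cycle m => m.succ
  | bridge ε => ⟨0, 3, !ε, by decide, by decide, by decide⟩

/-- The type of the pure sliding move in the decomposition. -/
def kind : Arrow → PSKind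
  | cycle m => m.succKind
  | bridge _ => .II

theorem exists_decomposes :
    ∀ a : Arrow, ∃ l r, a.source.Decomposes a.target a.kind l r := by
  decide +kernel

theorem eq_of_source_eq_of_kind_eq :
    ∀ {a b : Arrow}, a.source = b.source → a.kind = b.kind → a = b := by
  decide +kernel

theorem exists_slidingMove (a : Arrow) :
    ∃ x : LocalPSMove, x.base = a.source ∧ x.kind = a.kind ∧ x.CompletedBy a.target :=
  let ⟨_, _, h⟩ := a.exists_decomposes
  h.exists_localPSMove

/-- The local pure sliding move that labels an arrow. -/
noncomputable def slidingMove (a : Arrow) : LocalPSMove := a.exists_slidingMove.choose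

theorem base_slidingMove (a : Arrow) : a.slidingMove.base = a.source :=
  a.exists_slidingMove.choose_spec.1

theorem kind_slidingMove (a : Arrow) : a.slidingMove.kind = a.kind :=
  a.exists_slidingMove.choose_spec.2.1

theorem completedBy_slidingMove (a : Arrow) : a.slidingMove.CompletedBy a.target :=
  a.exists_slidingMove.choose_spec.2.2

theorem slidingMove_injective : slidingMove.Injective := fun a b h =>
  eq_of_source_eq_of_kind_eq (by rw [← base_slidingMove, h, base_slidingMove])
    (by rw [← kind_slidingMove, h, kind_slidingMove])

theorem ncard_range_slidingMove : (Set.range slidingMove).ncard = 18 := by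
  rw [← Nat.card_coe_set_eq, Nat.card_range_of_injective slidingMove_injective,
    Nat.card_eq_fintype_card]
  decide +kernel

end Arrow

namespace MPMove

/-- The arrow from `n` towards `m`, for `n ≠ m`, in a spanning tree with root `m`. It stays in the
cycle of `n`, unless `n` is the start of a bridge that leads to the cycle of `m`. -/
def treeArrow (m n : MPMove) : Arrow :=
  if n = (Arrow.bridge n.ε).source ∧ n.cycleIndex ≠ m.cycleIndex then .bridge n.ε else .cycle n

theorem source_treeArrow (m n : MPMove) : (m.treeArrow n).source = n := by
  unfold treeArrow
  split_ifs with h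
  exacts [h.1.symm, rfl]

theorem treeArrow_injective (m : MPMove) : m.treeArrow.Injective :=
  Function.LeftInverse.injective (source_treeArrow m)

theorem exists_iterate_treeArrow_eq :
    ∀ m n : MPMove, ∃ i < 16, (Arrow.target ∘ m.treeArrow)^[i] n = m := by
  decide +kernel

/-- The labels of the spanning tree with root `m`. -/
def treeSlides (m : MPMove) : Set LocalPSMove := (Arrow.slidingMove ∘ m.treeArrow) '' {m}ᶜ

theorem treeSlides_subset (m : MPMove) : m.treeSlides ⊆ Set.range Arrow.slidingMove := by
  rintro _ ⟨n, -, rfl⟩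
  exact ⟨_, rfl⟩

theorem ncard_treeSlides (m : MPMove) : m.treeSlides.ncard = 15 := by
  rw [treeSlides, Set.ncard_image_of_injective _
    (Arrow.slidingMove_injective.comp m.treeArrow_injective), Set.ncard_compl,
    Set.ncard_singleton, card_eq]

theorem derivable_treeSlides {B : ∀ {I O : Type}, OGraph I O → OGraph I O → Prop} {m : MPMove}
    (hB : ∀ (I O : Type) (Γ Γ' : OGraph I O), m.Move Γ Γ' → B Γ Γ') (n : MPMove) (I O : Type)
    (Γ Γ' : OGraph I O) (h : n.Move Γ Γ') : Derivable B m.treeSlides Γ Γ' := by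
  obtain ⟨i, -, hi⟩ := exists_iterate_treeArrow_eq m n
  induction i generalizing n I O with
  | zero =>
    obtain rfl : n = m := hi
    exact .rel _ _ (.inl (hB I O Γ Γ' h))
  | succ i ih =>
    rcases eq_or_ne n m with rfl | hnm
    · exact .rel _ _ (.inl (hB I O Γ Γ' h))
    · have hx : (m.treeArrow n).slidingMove ∈ m.treeSlides := ⟨n, hnm, rfl⟩
      refine .of_completedBy hx (m.treeArrow n).completedBy_slidingMove
        (fun I O Γ Γ' h => ih _ I O Γ Γ' h hi) ?_
      rwa [Arrow.base_slidingMove, source_treeArrow]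

end MPMove

/-! ### The primary MP move as one of the 16 MP moves -/

namespace PrimaryMP

instance : Fintype left.V := inferInstanceAs (Fintype (Fin 2))

instance : Fintype right.V := inferInstanceAs (Fintype (Fin 3))

instance : DecidableEq left.V := inferInstanceAs (DecidableEq (Fin 2))

instance : DecidableEq right.V := inferInstanceAs (DecidableEq (Fin 3))

theorem left_proper : left.Proper
  | 0 | 1 | 2 => rfl

theorem right_proper : right.Proper
  | 0 | 1 | 2 => rfl

/-- The one of the 16 MP moves that has the same two sides as the primary one, up to a renaming of
the crossings and the ends. -/
def mpMove : MPMove := ⟨1, 3, true, by decide, by decide, by decide⟩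

/-- The crossings of `left`, as crossings of `mpMove.left`. -/
def leftIncl : Empty ⊕ left.V → mpMove.left.V :=
  Sum.elim Empty.elim ![⟨3, rfl⟩, ⟨1, rfl⟩]

/-- The crossings of `right`, as crossings of `mpMove.right`. -/
def rightIncl : Empty ⊕ right.V → mpMove.right.V :=
  Sum.elim Empty.elim ![⟨0, rfl⟩, ⟨2, rfl⟩, ⟨4, rfl⟩]

theorem isReplacement_mpMove : OGraph.IsReplacement left_proper right_proper mpMove.left
    mpMove.right leftIncl rightIncl := by
  decide +kernel

theorem move_of_mpMove {I O : Type} {Γ Γ' : OGraph I O} (h : mpMove.Move Γ Γ') : Move Γ Γ' :=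
  OGraph.LocalMove.trans_part isReplacement_mpMove.localMove h left_proper right_proper
    mpMove.left_proper mpMove.right_proper

end PrimaryMP

theorem mainTheorem8_general :
    ∃ S : Set LocalPSMove, S.ncard = 18 ∧
      (∀ m : MPMove, ∃ A ⊆ S, A.ncard = 15 ∧
        ∀ (m' : MPMove) (I O : Type) (Γ Γ' : OGraph I O),
          m'.Move Γ Γ' → Derivable (fun Δ Δ' => m.Move Δ Δ') A Γ Γ') ∧
      (∃ A ⊆ S, A.ncard = 15 ∧
        ∀ (m' : MPMove) (I O : Type) (Γ Γ' : OGraph I O),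
          m'.Move Γ Γ' → Derivable (fun Δ Δ' => PrimaryMP.Move Δ Δ') A Γ Γ') :=
  ⟨Set.range Arrow.slidingMove, Arrow.ncard_range_slidingMove,
    fun m => ⟨m.treeSlides, m.treeSlides_subset, m.ncard_treeSlides,
      MPMove.derivable_treeSlides fun _ _ _ _ => id⟩,
    PrimaryMP.mpMove.treeSlides, MPMove.treeSlides_subset _, MPMove.ncard_treeSlides _,
    MPMove.derivable_treeSlides fun _ _ _ _ => PrimaryMP.move_of_mpMove⟩

theorem mainTheorem8 :
    ∃ S : Set LocalPSMove, S.ncard = 18 ∧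
      (∀ m : MPMove, ∃ A ⊆ S, A.ncard = 15 ∧
        ∀ (m' : MPMove) (I O : Type) [Finite I] [Finite O] (Γ Γ' : OGraph I O),
          m'.Move Γ Γ' → Derivable (fun Δ Δ' => m.Move Δ Δ') A Γ Γ') ∧
      (∃ A ⊆ S, A.ncard = 15 ∧
        ∀ (m' : MPMove) (I O : Type) [Finite I] [Finite O] (Γ Γ' : OGraph I O),
          m'.Move Γ Γ' → Derivable (fun Δ Δ' => PrimaryMP.Move Δ Δ') A Γ Γ') := by
  obtain ⟨S, hS, hM, hP⟩ := mainTheorem8_general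
  exact ⟨S, hS, fun m => (hM m).imp fun _ ⟨hA, hA', h⟩ => ⟨hA, hA', fun m' I O _ _ => h m' I O⟩,
    hP.imp fun _ ⟨hA, hA', h⟩ => ⟨hA, hA', fun m' I O _ _ => h m' I O⟩⟩
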